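/- Let $P\subset\mathbf{R}^n$ be the moment polytope of an $n$-dimensional polarised toric variety: the interior of a bounded full-dimensional polytope with integral vertices, $P=\{x : h_k(x)>c_k,\ k=1,\dots,m\}$, with exactly one inequality for each codimension one face, where each $h_k$ is a primitive integral linear form $\mathbf{Z}^n\to\mathbf{Z}$. Let $d\mu$ be Lebesgue measure on $P$ and let $d\sigma$ be the measure on $\partial P$ which on the face $\{h_k=c_k\}$ is determined by $d\sigma\wedge dh_k=\pm d\mu$. Let $\hat S=\mathrm{Vol}(\partial P,d\sigma)/\mathrm{Vol}(P,d\mu)$. Let $P^*$ be the union of $P$ and its relatively open codimension one faces, and let $\mathcal{C}_1$ be the set of continuous convex functions on $P^*$ that are integrable on $\partial P$ with respect to $d\sigma$. For $A\in L^2(P)$ and $f\in\mathcal{C}_1\cap L^2(P)$ put \[ \mathcal{L}_A(f)=\int_{\partial P} f\,d\sigma-\int_P Af\,d\mu,\qquad \mathcal{L}(f)=\mathcal{L}_{\hat S}(f), \] and $W(f)=\mathcal{L}(f)/\Vert f\Vert_{L^2(P)}$ if $f\neq 0$, $W(0)=0$. Theorem. Suppose that $P$ is unstable, i.e. $\mathcal{L}(f)<0$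 for some $f\in\mathcal{C}_1\cap L^2(P)$. Then $W$ attains its minimum over $\mathcal{C}_1\cap L^2(P)$ at some $\Phi\in\mathcal{C}_1\cap L^2(P)$, and the minimiser is unique up to scaling: the minimisers are exactly the positive multiples of $\Phi$. There is exactly one minimiser $\Phi$ with \[ \mathcal{L}(\Phi)=-\Vert\Phi\Vert_{L^2(P)}^2. \] For this $\Phi$, the function $B=\hat S-\Phi$ satisfies $\mathcal{L}_B(f)\geq 0$ for all $f\in\mathcal{C}_1\cap L^2(P)$, and $\mathcal{L}_B(\Phi)=0$. Conversely, these two conditions characterise $\Phi$: if $\Psi\in\mathcal{C}_1\cap L^2(P)$ satisfies $\mathcal{L}_{\hat S-\Psi}(f)\geq 0$ for all $f\in\mathcal{C}_1\cap L^2(P)$ and $\mathcal{L}_{\hat S-\Psi}(\Psi)=0$, then $\Psi=\Phi$ on $P^*$. -/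

import Mathlib

open MeasureTheory Set
open scoped ENNReal

noncomputable section

/-- The moment polytope of an `n`-dimensional polarised toric variety: a full-dimensional bounded
integral polytope in `ℝⁿ`, given by inequalities `h_k(x) > c_k`, one for each codimension one face,
where each `h_k` is a primitive integral linear form. -/
structure MomentPolytope (n : ℕ) where
  /-- the number of codimension one faces -/
  numFacets : ℕ
  /-- the coefficients of the linear form `h_k` -/
  normal : Fin numFacets → Fin n → ℤ
  /-- the constant `c_k` -/
  offset : Fin numFacets → ℝ
  primitive : ∀ k, Finset.univ.gcd (normal k) = 1
  nonempty_interior : ∃ x : EuclideanSpace ℝ (Fin n),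
    ∀ k, offset k < ∑ i, (normal k i : ℝ) * x i
  bounded : Bornology.IsBounded
    {x : EuclideanSpace ℝ (Fin n) | ∀ k, offset k ≤ ∑ i, (normal k i : ℝ) * x i}
  /-- no inequality is redundant (or repeated): each of them cuts out a codimension one face -/
  irredundant : ∀ k, ∃ x : EuclideanSpace ℝ (Fin n),
    ∑ i, (normal k i : ℝ) * x i = offset k ∧
      ∀ j, j ≠ k → offset j < ∑ i, (normal j i : ℝ) * x i
  /-- the vertices are integral points -/
  integral_vertices : ∀ v ∈ Set.extremePoints ℝ
    {x : EuclideanSpace ℝ (Fin n) | ∀ k, offset k ≤ ∑ i, (normal k i : ℝ) * x i},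
    ∀ i, ∃ z : ℤ, v i = z

namespace MomentPolytope

variable {n : ℕ} (P : MomentPolytope n)

/-- The affine function `δ_k(x) = h_k(x) - c_k`. -/
def δ (k : Fin P.numFacets) (x : EuclideanSpace ℝ (Fin n)) : ℝ :=
  ∑ i, (P.normal k i : ℝ) * x i - P.offset k

/-- The interior of the polytope. -/
def interiorSet : Set (EuclideanSpace ℝ (Fin n)) := {x | ∀ k, 0 < P.δ k x}

/-- The relatively open codimension one face on which `h_k = c_k`. -/
def facet (k : Fin P.numFacets) : Set (EuclideanSpace ℝ (Fin n)) :=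
  {x | P.δ k x = 0 ∧ ∀ j, j ≠ k → 0 < P.δ j x}

/-- `P*`: the union of the (open) polytope and its (relatively open) codimension one faces. -/
def star : Set (EuclideanSpace ℝ (Fin n)) := P.interiorSet ∪ ⋃ k, P.facet k

/-- The measure `dμ`: Lebesgue measure on the polytope. -/
def μ : Measure (EuclideanSpace ℝ (Fin n)) := volume.restrict P.interiorSet

/-- The Euclidean length of the conormal vector `h_k`. -/
def normalLength (k : Fin P.numFacets) : ℝ :=
  ‖(WithLp.toLp 2 (fun i => (P.normal k i : ℝ)) : EuclideanSpace ℝ (Fin n))‖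

/-- The boundary measure `dσ`. On the face `h_k = c_k` the condition `dσ ∧ dh_k = ± dμ` says that
`dσ` is the Euclidean area measure divided by the length of `h_k`. The faces of codimension at
least two are null sets, so only the relatively open faces of codimension one contribute. -/
def σ : Measure (EuclideanSpace ℝ (Fin n)) :=
  ∑ k, ENNReal.ofReal (P.normalLength k)⁻¹ •
    (Measure.euclideanHausdorffMeasure (n - 1)).restrict (P.facet k)

/-- The constant `Ŝ = Vol(∂P, dσ) / Vol(P, dμ)`. -/
def Shat : ℝ := P.σ.real univ / P.μ.real univ

/-- `f ∈ 𝓒₁`: a continuous convex function on `P*` which is integrable on the boundary. Only the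
values of `f` on `P*` matter. -/
structure MemC1 (f : EuclideanSpace ℝ (Fin n) → ℝ) : Prop where
  convexOn : ConvexOn ℝ P.star f
  continuousOn : ContinuousOn f P.star
  integrable : Integrable f P.σ

/-- `f ∈ 𝓒₁ ∩ L²(P)`. -/
def MemC1L2 (f : EuclideanSpace ℝ (Fin n) → ℝ) : Prop := P.MemC1 f ∧ MemLp f 2 P.μ

/-- The `L²(P)`-norm. -/
def normL2 (f : EuclideanSpace ℝ (Fin n) → ℝ) : ℝ := lpNorm f 2 P.μ

/-- `𝓛_A(f) = ∫_{∂P} f dσ - ∫_P A f dμ`, for `A ∈ L²(P)` and `f ∈ 𝓒₁ ∩ L²(P)`. -/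
def L_ (A f : EuclideanSpace ℝ (Fin n) → ℝ) : ℝ := ∫ x, f x ∂P.σ - ∫ x, A x * f x ∂P.μ

/-- `𝓛 = 𝓛_Ŝ`. -/
def L (f : EuclideanSpace ℝ (Fin n) → ℝ) : ℝ := P.L_ (fun _ => P.Shat) f

/-- The normalised Futaki invariant `W(f) = 𝓛(f) / ‖f‖`; for `f = 0` the division by zero gives
the conventional value `W(0) = 0`. -/
def W (f : EuclideanSpace ℝ (Fin n) → ℝ) : ℝ := P.L f / P.normL2 f

/-- The toric variety is unstable: `𝓛(f) < 0` for some convex `f`. -/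
def Unstable : Prop := ∃ f, P.MemC1L2 f ∧ P.L f < 0

/-- `Φ` is a convex minimiser of `W` in `𝓒₁ ∩ L²(P)`. -/
def IsMinimiser (Φ : EuclideanSpace ℝ (Fin n) → ℝ) : Prop :=
  P.MemC1L2 Φ ∧ ∀ f, P.MemC1L2 f → P.W Φ ≤ P.W f

end MomentPolytope

end

/-!
The functional `W` is minimised through the strictly convex functional `½ ‖f‖² + 𝓛(f)` (`energy`) on
the convex cone `𝓒₁ ∩ L²`, whose minimiser is the normalised minimiser of `W`.

The energy is bounded below because a convex function on `P*` is bounded below by a multiple of its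
`L²` norm (`exists_lower_bound`). By the parallelogram law (`energy_midpoint`) a minimising sequence
is Cauchy in `L²`, so that it converges strongly and no weak compactness is needed.

The cone is not closed in `L²`, and the boundary integral is not continuous; what holds is that an
`L²` limit of functions in the cone, with convergent boundary integrals, is represented by a function
in the cone whose boundary integral is not larger (`exists_memC1L2_of_tendsto`). On the interior the
representative is a pointwise limit, since convex functions that converge almost everywhere converge
everywhere (`ConvexOn.exists_tendsto_of_ae_tendsto`). It is extended to the facets as a supremum of
continuous convex functions, hence lower semicontinuously; a convex function on `P*` is automatically
upper semicontinuous (`continuousOn_star`), and Fatou's lemma bounds the boundary integral.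

The first variation of the energy at its minimiser `Φ` gives `𝓛(f) + ⟨Φ, f⟩ ≥ 0` for all `f` in the
cone and `𝓛(Φ) = -‖Φ‖²` (`variation_of_energy_minimiser`). The remaining claims are consequences of
these two facts: by Cauchy–Schwarz `W(f) ≥ -‖Φ‖ = W(Φ)`, with equality only for positive multiples of
`Φ`, and two functions satisfying both conditions coincide because the conditions for each, tested on
the other, give `‖Φ - Ψ‖² ≤ 0`.
-/

open Filter Topology

namespace MomentPolytope

variable {n : ℕ} (P : MomentPolytope n)

/-! ### Geometry of the polytope -/

lemma δ_combo (k : Fin P.numFacets) (x y : EuclideanSpace ℝ (Fin n)) {a b : ℝ} (hab : a + b = 1) :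
    P.δ k (a • x + b • y) = a * P.δ k x + b * P.δ k y := by
  have h : ∑ i, (P.normal k i : ℝ) * (a • x + b • y) i
      = a * (∑ i, (P.normal k i : ℝ) * x i) + b * ∑ i, (P.normal k i : ℝ) * y i := by
    rw [Finset.mul_sum, Finset.mul_sum, ← Finset.sum_add_distrib]
    refine Finset.sum_congr rfl fun i _ => ?_
    simp only [PiLp.add_apply, PiLp.smul_apply, smul_eq_mul]
    ring
  unfold δ
  rw [h]
  linear_combination P.offset k * hab

lemma continuous_δ (k : Fin P.numFacets) : Continuous (P.δ k) := by
  unfold δ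
  fun_prop

lemma isOpen_interiorSet : IsOpen P.interiorSet := by
  simp only [interiorSet, ofPred_forall]
  exact isOpen_iInter_of_finite fun k => isOpen_lt continuous_const (P.continuous_δ k)

lemma exists_mem_interiorSet : ∃ p, p ∈ P.interiorSet := by
  obtain ⟨x, hx⟩ := P.nonempty_interior
  exact ⟨x, fun k => sub_pos.2 (hx k)⟩

lemma mem_star_iff {x : EuclideanSpace ℝ (Fin n)} :
    x ∈ P.star ↔ (∀ k, 0 ≤ P.δ k x) ∧ ∀ j k, P.δ j x = 0 → P.δ k x = 0 → j = k := by
  constructor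
  · rintro (h | h)
    · exact ⟨fun k => (h k).le, fun j k hj _ => absurd hj (h j).ne'⟩
    · obtain ⟨i, hi, hx⟩ := mem_iUnion.1 h
      have key : ∀ j, P.δ j x = 0 → j = i := fun j hj => by
        by_contra hne
        exact (hx j hne).ne' hj
      refine ⟨fun k => ?_, fun j k hj hk => (key j hj).trans (key k hk).symm⟩
      by_cases hk : k = i
      · rw [hk, hi]
      · exact (hx k hk).le
  · rintro ⟨h0, h1⟩
    by_cases h : ∃ k, P.δ k x = 0
    · obtain ⟨k, hk⟩ := h
      exact Or.inr (mem_iUnion.2 ⟨k, hk, fun j hj =>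
        (h0 j).lt_of_ne fun h => hj (h1 j k h.symm hk)⟩)
    · push Not at h
      exact Or.inl fun k => (h0 k).lt_of_ne (h k).symm

lemma interiorSet_subset_star : P.interiorSet ⊆ P.star := subset_union_left

lemma facet_subset_star (k : Fin P.numFacets) : P.facet k ⊆ P.star :=
  (subset_iUnion P.facet k).trans subset_union_right

lemma convex_interiorSet : Convex ℝ P.interiorSet := by
  intro x hx y hy a b ha hb hab k
  rw [P.δ_combo k x y hab]
  rcases ha.eq_or_lt with rfl | ha
  · rw [zero_add] at hab
    simpa [hab] using hy k
  · exact add_pos_of_pos_of_nonneg (mul_pos ha (hx k)) (mul_nonneg hb (hy k).le)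

lemma convex_star : Convex ℝ P.star := by
  rw [convex_iff_forall_pos]
  intro x hx y hy a b ha hb hab
  rw [mem_star_iff] at hx hy ⊢
  refine ⟨fun k => ?_, fun j k hj hk => ?_⟩
  · rw [P.δ_combo k x y hab]
    exact add_nonneg (mul_nonneg ha.le (hx.1 k)) (mul_nonneg hb.le (hy.1 k))
  · rw [P.δ_combo _ x y hab] at hj hk
    have aux : ∀ i, a * P.δ i x + b * P.δ i y = 0 → P.δ i x = 0 := fun i hi => by
      have h1 := mul_nonneg ha.le (hx.1 i)
      have h2 := mul_nonneg hb.le (hy.1 i)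
      exact (mul_eq_zero.1 (by linarith : a * P.δ i x = 0)).resolve_left ha.ne'
    exact hx.2 j k (aux j hj) (aux k hk)

/-- A point of `P*`, moved any positive amount towards an interior point, is interior. -/
lemma combo_mem_interiorSet {x p : EuclideanSpace ℝ (Fin n)} (hx : x ∈ P.star)
    (hp : p ∈ P.interiorSet) {t : ℝ} (ht : 0 < t) (ht1 : t ≤ 1) :
    (1 - t) • x + t • p ∈ P.interiorSet := by
  intro k
  rw [P.δ_combo k x p (by ring)]
  exact add_pos_of_nonneg_of_pos (mul_nonneg (by linarith) ((P.mem_star_iff.1 hx).1 k))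
    (mul_pos ht (hp k))

lemma tendsto_combo (x p : EuclideanSpace ℝ (Fin n)) :
    Tendsto (fun t : ℝ => (1 - t) • x + t • p) (𝓝[>] 0) (𝓝 x) := by
  have : Continuous fun t : ℝ => (1 - t) • x + t • p := by fun_prop
  simpa using (this.tendsto 0).mono_left nhdsWithin_le_nhds

lemma star_subset_closure : P.star ⊆ closure P.interiorSet := by
  intro x hx
  obtain ⟨p, hp⟩ := P.exists_mem_interiorSet
  refine mem_closure_of_tendsto (tendsto_combo x p) ?_
  filter_upwards [Ioc_mem_nhdsGT (zero_lt_one' ℝ)] with t ht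
  exact P.combo_mem_interiorSet hx hp ht.1 ht.2

lemma isBounded_star : Bornology.IsBounded P.star :=
  P.bounded.subset fun _ hx k => sub_nonneg.1 ((P.mem_star_iff.1 hx).1 k)

lemma measurableSet_facet (k : Fin P.numFacets) : MeasurableSet (P.facet k) := by
  have h : P.facet k = {x | P.δ k x = 0} ∩ ⋂ j, ⋂ (_ : j ≠ k), {x | 0 < P.δ j x} := by
    ext x
    simp [facet]
  rw [h]
  exact (isClosed_eq (P.continuous_δ k) continuous_const).measurableSet.inter
    (MeasurableSet.iInter fun j => MeasurableSet.iInter fun _ =>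
      (isOpen_lt continuous_const (P.continuous_δ j)).measurableSet)

lemma measurableSet_interiorSet : MeasurableSet P.interiorSet := P.isOpen_interiorSet.measurableSet

lemma measurableSet_star : MeasurableSet P.star :=
  P.measurableSet_interiorSet.union (MeasurableSet.iUnion P.measurableSet_facet)

/-! ### The measures on the polytope and its boundary -/

instance : IsFiniteMeasure P.μ :=
  isFiniteMeasure_restrict.2 (P.isBounded_star.subset P.interiorSet_subset_star).measure_lt_top.ne

lemma ae_μ_mem_interiorSet : ∀ᵐ x ∂P.μ, x ∈ P.interiorSet :=
  ae_restrict_mem P.measurableSet_interiorSet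

/-- The linear form `h_k` as a vector. -/
def conormal (k : Fin P.numFacets) : EuclideanSpace ℝ (Fin n) :=
  WithLp.toLp 2 (fun i => (P.normal k i : ℝ))

lemma conormal_ne_zero (k : Fin P.numFacets) : P.conormal k ≠ 0 := by
  intro h
  have h0 : ∀ i, P.normal k i = 0 := fun i => by
    have : P.conormal k i = 0 := by rw [h]; rfl
    simpa [conormal] using this
  have h1 := P.primitive k
  rw [Finset.gcd_eq_zero_iff.2 fun i _ => h0 i] at h1
  exact zero_ne_one h1

lemma δ_eq_inner (k : Fin P.numFacets) (x : EuclideanSpace ℝ (Fin n)) :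
    P.δ k x = inner ℝ (P.conormal k) x - P.offset k := by
  simp [δ, conormal, PiLp.inner_apply, mul_comm]

lemma normalLength_pos (k : Fin P.numFacets) : 0 < P.normalLength k :=
  norm_pos_iff.2 (P.conormal_ne_zero k)

/-- The affine hyperplane through a facet, parametrised isometrically by `ℝⁿ⁻¹`. -/
lemma exists_isometry_range_eq {k : Fin P.numFacets} {x₀ : EuclideanSpace ℝ (Fin n)}
    (hx₀ : P.δ k x₀ = 0) :
    ∃ e : EuclideanSpace ℝ (Fin (n - 1)) → EuclideanSpace ℝ (Fin n),
      Isometry e ∧ e 0 = x₀ ∧ range e = {x | P.δ k x = 0} := by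
  have hn : n ≠ 0 := by
    rintro rfl
    exact P.conormal_ne_zero k (Subsingleton.elim _ _)
  have : Fact (Module.finrank ℝ (EuclideanSpace ℝ (Fin n)) = (n - 1) + 1) :=
    ⟨by rw [finrank_euclideanSpace_fin]; omega⟩
  have hd : Module.finrank ℝ (Submodule.span ℝ {P.conormal k})ᗮ = n - 1 :=
    Submodule.finrank_orthogonal_span_singleton (P.conormal_ne_zero k)
  let ι := ((stdOrthonormalBasis ℝ (Submodule.span ℝ {P.conormal k})ᗮ).reindex
    (finCongr hd)).repr.symm
  refine ⟨fun v => x₀ + (ι v : EuclideanSpace ℝ (Fin n)), ?_, by simp, ?_⟩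
  · exact (isometry_add_left x₀).comp (isometry_subtype_coe.comp ι.isometry)
  · have hδ : ∀ w, P.δ k (x₀ + w) = inner ℝ (P.conormal k) w := fun w => by
      rw [δ_eq_inner] at hx₀ ⊢
      rw [inner_add_right]
      linarith
    ext x
    constructor
    · rintro ⟨v, rfl⟩
      exact (hδ _).trans (Submodule.mem_orthogonal_singleton_iff_inner_right.1 (ι v).2)
    · intro hx
      refine ⟨ι.symm ⟨x - x₀, ?_⟩, by simp⟩
      rw [Submodule.mem_orthogonal_singleton_iff_inner_right, ← hδ]
      simpa using hx

open Measure in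
lemma euclideanHausdorffMeasure_facet_lt_top (k : Fin P.numFacets) :
    euclideanHausdorffMeasure (n - 1) (P.facet k) < ∞ := by
  rcases (P.facet k).eq_empty_or_nonempty with h | ⟨x₀, hx₀⟩
  · simp [h]
  obtain ⟨e, he, -, hr⟩ := P.exists_isometry_range_eq hx₀.1
  have hsub : P.facet k ⊆ range e := fun x hx => hr ▸ hx.1
  rw [← inter_eq_left.2 hsub, ← he.euclideanHausdorffMeasure_preimage,
    EuclideanSpace.euclideanHausdorffMeasure_eq_volume]
  exact (he.antilipschitz.isBounded_preimage
    (P.isBounded_star.subset (P.facet_subset_star k))).measure_lt_top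

instance : IsFiniteMeasure P.σ := by
  refine ⟨?_⟩
  simp only [σ, Measure.coe_finsetSum, Finset.sum_apply, Measure.smul_apply, smul_eq_mul,
    Measure.restrict_apply_univ]
  exact ENNReal.sum_lt_top.2 fun k _ =>
    ENNReal.mul_lt_top ENNReal.ofReal_lt_top (P.euclideanHausdorffMeasure_facet_lt_top k)

lemma ae_σ_iff {Q : EuclideanSpace ℝ (Fin n) → Prop} :
    (∀ᵐ x ∂P.σ, Q x) ↔
      ∀ k, ∀ᵐ x ∂(Measure.euclideanHausdorffMeasure (n - 1)).restrict (P.facet k), Q x := by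
  simp only [ae_iff, σ, Measure.coe_finsetSum, Finset.sum_apply, Measure.smul_apply, smul_eq_mul,
    Finset.sum_eq_zero_iff, Finset.mem_univ, true_imp_iff, mul_eq_zero]
  refine forall_congr' fun k => or_iff_right ?_
  simpa using P.normalLength_pos k

lemma ae_σ_mem_star : ∀ᵐ x ∂P.σ, x ∈ P.star := by
  rw [ae_σ_iff]
  intro k
  filter_upwards [ae_restrict_mem (P.measurableSet_facet k)] with x hx
  exact P.facet_subset_star k hx

/-- A property that holds almost everywhere on the boundary holds at two points of a facet which
are symmetric about a given point of that facet. -/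
lemma exists_symmetric_of_ae_σ {Q : EuclideanSpace ℝ (Fin n) → Prop} (hQ : ∀ᵐ x ∂P.σ, Q x)
    {k : Fin P.numFacets} {x : EuclideanSpace ℝ (Fin n)} (hx : x ∈ P.facet k) :
    ∃ y ∈ P.star, ∃ z ∈ P.star, x = (1 / 2 : ℝ) • y + (1 / 2 : ℝ) • z ∧ Q y ∧ Q z := by
  obtain ⟨e, he, he0, hr⟩ := P.exists_isometry_range_eq hx.1
  have hQk : ∀ᵐ v : EuclideanSpace ℝ (Fin (n - 1)), e v ∈ P.facet k → Q (e v) := by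
    have h := P.ae_σ_iff.1 hQ k
    rw [ae_restrict_iff' (P.measurableSet_facet k), ae_iff] at h
    rw [← EuclideanSpace.euclideanHausdorffMeasure_eq_volume, ae_iff]
    change Measure.euclideanHausdorffMeasure (n - 1) (e ⁻¹' {x | ¬(x ∈ P.facet k → Q x)}) = 0
    rw [he.euclideanHausdorffMeasure_preimage]
    exact measure_mono_null inter_subset_left h
  -- Both `e v` and its mirror image `2 x - e v` are in the facet, for `v` near `0`.
  let τ : EuclideanSpace ℝ (Fin n) ≃ᵢ EuclideanSpace ℝ (Fin n) := IsometryEquiv.subLeft (x + x)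
  have hmir : ∀ y, P.δ k y = 0 → P.δ k (x + x - y) = 0 := fun y hy => by
    have h1 : x + x - y = (2 : ℝ) • x + (-1 : ℝ) • y := by module
    rw [h1, P.δ_combo k _ _ (by norm_num), hx.1, hy]
    simp
  have hQk' : ∀ᵐ v : EuclideanSpace ℝ (Fin (n - 1)), x + x - e v ∈ P.facet k →
      Q (x + x - e v) := by
    have h := P.ae_σ_iff.1 hQ k
    rw [ae_restrict_iff' (P.measurableSet_facet k), ae_iff] at h
    have hτ : Isometry fun v => x + x - e v := τ.isometry.comp he
    rw [← EuclideanSpace.euclideanHausdorffMeasure_eq_volume, ae_iff]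
    change Measure.euclideanHausdorffMeasure (n - 1)
      ((fun v => x + x - e v) ⁻¹' {x | ¬(x ∈ P.facet k → Q x)}) = 0
    rw [hτ.euclideanHausdorffMeasure_preimage]
    exact measure_mono_null inter_subset_left h
  have hnear : ∀ᶠ y in 𝓝 x, ∀ j, j ≠ k → 0 < P.δ j y :=
    eventually_all.2 fun j => by
      by_cases hj : j = k
      · exact Eventually.of_forall fun y h => absurd hj h
      · filter_upwards [(P.continuous_δ j).continuousAt.eventually_const_lt (hx.2 j hj)] with y hy _
        exact hy
  have hm : ∀ᶠ v in 𝓝 (0 : EuclideanSpace ℝ (Fin (n - 1))), ∀ j, j ≠ k → 0 < P.δ j (e v) := by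
    have := he.continuous.tendsto 0
    rw [he0] at this
    exact this.eventually hnear
  have hm' : ∀ᶠ v in 𝓝 (0 : EuclideanSpace ℝ (Fin (n - 1))),
      ∀ j, j ≠ k → 0 < P.δ j (x + x - e v) := by
    have hc : Continuous fun v => x + x - e v := continuous_const.sub he.continuous
    have h0 : x + x - e 0 = x := by rw [he0, add_sub_cancel_right]
    exact (h0 ▸ hc.tendsto 0).eventually hnear
  obtain ⟨U, hU, hUo, h0U⟩ := mem_nhds_iff.1 (hm.and hm')
  obtain ⟨v, hvU, hv⟩ : ∃ v ∈ U, (e v ∈ P.facet k → Q (e v)) ∧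
      (x + x - e v ∈ P.facet k → Q (x + x - e v)) := by
    by_contra! hcon
    refine (hUo.measure_pos volume ⟨0, h0U⟩).ne' (measure_mono_null ?_ (hQk.and hQk'))
    intro v hv h
    obtain ⟨h1, h2⟩ := hcon v hv h.1
    exact h2 (h.2 h1)
  have hev : P.δ k (e v) = 0 := by
    have : e v ∈ range e := mem_range_self v
    rwa [hr] at this
  have hy : e v ∈ P.facet k := ⟨hev, (hU hvU).1⟩
  have hz : x + x - e v ∈ P.facet k := ⟨hmir _ hev, (hU hvU).2⟩
  exact ⟨e v, P.facet_subset_star k hy, _, P.facet_subset_star k hz, by module, hv.1 hy, hv.2 hz⟩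

/-! ### The uniform lower bound for convex functions -/

/-- A convex function on `P*` is bounded below by a multiple of its `L¹` norm. For a point `x` of
`P*` and `y` in a small ball, `y` is on a segment from `x` to a point `T y` still in the polytope;
convexity bounds `f x` below through `f y` and `f (T y)`, and this is averaged over `y`. -/
lemma exists_lower_bound : ∃ C : ℝ, 0 ≤ C ∧ ∀ f : EuclideanSpace ℝ (Fin n) → ℝ,
    ConvexOn ℝ P.star f → Integrable f P.μ → ∀ x ∈ P.star, -(C * ∫ y, |f y| ∂P.μ) ≤ f x := by
  obtain ⟨p, hp⟩ := P.exists_mem_interiorSet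
  obtain ⟨ρ, hρ, hball⟩ := Metric.isOpen_iff.1 P.isOpen_interiorSet p hp
  obtain ⟨R, hR⟩ := P.isBounded_star.subset_closedBall p
  have hR0 : 0 ≤ R := by
    simpa using hR (P.interiorSet_subset_star hp)
  obtain ⟨r, hr, hrρ⟩ : ∃ r : ℝ, 0 < r ∧ 2 * r = ρ := ⟨ρ / 2, by positivity, by ring⟩
  -- With this `s`, the points `T y` stay in the ball of radius `2 r`.
  obtain ⟨s, hs, hsr⟩ : ∃ s : ℝ, 0 < s ∧ s⁻¹ * (R + r) = r :=
    ⟨(R + r) / r, by positivity, by field_simp⟩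
  have hB : 0 < volume.real (Metric.ball p r) :=
    ENNReal.toReal_pos (Metric.measure_ball_pos volume p hr).ne' measure_ball_lt_top.ne
  refine ⟨(1 + 2 * s) / volume.real (Metric.ball p r), by positivity, fun f hf hfi x hx => ?_⟩
  set h : EuclideanSpace ℝ (Fin n) → ℝ := P.interiorSet.indicator fun y => |f y| with hh
  have hh0 : ∀ y, 0 ≤ h y := fun y => indicator_nonneg (fun _ _ => abs_nonneg _) y
  have hhi : Integrable h := (integrable_indicator_iff P.measurableSet_interiorSet).2 hfi.abs
  have hhint : ∫ y, h y = ∫ y, |f y| ∂P.μ := integral_indicator P.measurableSet_interiorSet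
  have hh_eq : ∀ y ∈ P.interiorSet, h y = |f y| := fun y hy => indicator_of_mem hy _
  have hc0 : (1 + s⁻¹ : ℝ) ≠ 0 := by positivity
  have hHi : Integrable fun y => h (x + (1 + s⁻¹) • (y - x)) :=
    ((hhi.comp_add_left x).comp_smul hc0).comp_sub_right x
  have hHint : ∫ y, h (x + (1 + s⁻¹) • (y - x)) ≤ ∫ y, h y := by
    rw [integral_sub_right_eq_self (fun y => h (x + (1 + s⁻¹) • y)) x,
      Measure.integral_comp_smul volume (fun y => h (x + y)) (1 + s⁻¹),
      integral_add_left_eq_self h x, smul_eq_mul]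
    refine mul_le_of_le_one_left (integral_nonneg hh0) ?_
    rw [abs_of_nonneg (by positivity)]
    exact inv_le_one_of_one_le₀ (one_le_pow₀ (by linarith [inv_pos.2 hs]))
  have hpt : ∀ y ∈ Metric.ball p r,
      -((1 + s) * h y + s * h (x + (1 + s⁻¹) • (y - x))) ≤ f x := by
    intro y hy
    have hyP : y ∈ P.interiorSet := hball (Metric.ball_subset_ball (by linarith) hy)
    set z := x + (1 + s⁻¹) • (y - x) with hz
    have hzP : z ∈ P.interiorSet := by
      refine hball ?_
      rw [Metric.mem_ball, dist_eq_norm] at hy ⊢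
      have hxp : ‖p - x‖ ≤ R := by
        rw [← dist_eq_norm, dist_comm]
        exact hR hx
      have e1 : z - p = (y - p) + s⁻¹ • ((p - x) + (y - p)) := by
        rw [hz]
        module
      calc ‖z - p‖ ≤ ‖y - p‖ + s⁻¹ * (‖p - x‖ + ‖y - p‖) := by
            rw [e1]
            refine (norm_add_le _ _).trans (add_le_add le_rfl ?_)
            rw [norm_smul, Real.norm_of_nonneg (by positivity)]
            gcongr
            exact norm_add_le _ _
        _ < r + s⁻¹ * (R + r) :=
            add_lt_add_of_lt_of_le hy (mul_le_mul_of_nonneg_left (add_le_add hxp hy.le)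
              (by positivity))
        _ = ρ := by linarith
    have hyz : y = (1 / (1 + s)) • x + (s / (1 + s)) • z := by
      have e1 : 1 / (1 + s) + s / (1 + s) = 1 := by field_simp
      have e2 : s / (1 + s) * (1 + s⁻¹) = 1 := by field_simp; ring
      have e3 : (1 / (1 + s)) • x + (s / (1 + s)) • z
          = (1 / (1 + s) + s / (1 + s)) • x + (s / (1 + s) * (1 + s⁻¹)) • (y - x) := by
        rw [hz]
        module
      rw [e3, e1, e2]
      module
    have hcv := hf.2 hx (P.interiorSet_subset_star hzP) (by positivity : 0 ≤ 1 / (1 + s))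
      (by positivity : 0 ≤ s / (1 + s)) (by field_simp)
    rw [← hyz, smul_eq_mul, smul_eq_mul] at hcv
    have hcv' : (1 + s) * f y ≤ f x + s * f z := by
      have := mul_le_mul_of_nonneg_left hcv (by positivity : 0 ≤ 1 + s)
      calc (1 + s) * f y ≤ _ := this
        _ = f x + s * f z := by field_simp
    rw [hh_eq y hyP, hh_eq z hzP]
    have h1 := mul_le_mul_of_nonneg_left (neg_abs_le (f y)) (by positivity : 0 ≤ 1 + s)
    have h2 := mul_le_mul_of_nonneg_left (le_abs_self (f z)) hs.le
    linarith
  have hint : -((1 + 2 * s) * ∫ y, h y) ≤ volume.real (Metric.ball p r) * f x := by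
    have hi : Integrable fun y => (1 + s) * h y + s * h (x + (1 + s⁻¹) • (y - x)) :=
      (hhi.const_mul _).add (hHi.const_mul _)
    calc -((1 + 2 * s) * ∫ y, h y)
        ≤ -∫ y, ((1 + s) * h y + s * h (x + (1 + s⁻¹) • (y - x))) := by
          rw [integral_add (hhi.const_mul _) (hHi.const_mul _), integral_const_mul,
            integral_const_mul]
          have := mul_le_mul_of_nonneg_left hHint hs.le
          linarith
      _ ≤ -∫ y in Metric.ball p r, ((1 + s) * h y + s * h (x + (1 + s⁻¹) • (y - x))) := by
          refine neg_le_neg (setIntegral_le_integral hi (Eventually.of_forall fun y => ?_))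
          have h1 := hh0 y
          have h2 := hh0 (x + (1 + s⁻¹) • (y - x))
          change 0 ≤ (1 + s) * h y + s * h (x + (1 + s⁻¹) • (y - x))
          positivity
      _ = ∫ y in Metric.ball p r, -((1 + s) * h y + s * h (x + (1 + s⁻¹) • (y - x))) :=
          (integral_neg _).symm
      _ ≤ ∫ y in Metric.ball p r, f x :=
          setIntegral_mono_on hi.neg.integrableOn
            (integrableOn_const measure_ball_lt_top.ne) measurableSet_ball hpt
      _ = volume.real (Metric.ball p r) * f x := by
          rw [setIntegral_const, smul_eq_mul]
  rw [hhint] at hint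
  rw [div_mul_eq_mul_div, neg_le, le_div_iff₀ hB]
  linarith

/-! ### Convergence of convex functions -/

/-- Arbitrarily near a point `x` of an open set there is a point which, together with its mirror
image about `x`, lies in the set and has a given almost everywhere property. -/
lemma _root_.MeasureTheory.exists_symmetric_of_ae_restrict {E : Type*} [NormedAddCommGroup E]
    [MeasurableSpace E] [BorelSpace E] (ν : Measure E)
    [ν.IsAddLeftInvariant] [ν.IsNegInvariant] [SFinite ν] [SecondCountableTopology E]
    [ν.IsOpenPosMeasure]
    {U : Set E} (hU : IsOpen U) {Q : E → Prop} (hQ : ∀ᵐ x ∂ν.restrict U, Q x) {x : E} (hx : x ∈ U)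
    {W : Set E} (hW : W ∈ 𝓝 x) :
    ∃ y ∈ W, y ∈ U ∧ x + x - y ∈ U ∧ Q y ∧ Q (x + x - y) := by
  rw [ae_restrict_iff' hU.measurableSet] at hQ
  have hQ' : ∀ᵐ y ∂ν, x + x - y ∈ U → Q (x + x - y) :=
    (quasiMeasurePreserving_sub_left ν (x + x)).ae hQ
  have hc : Tendsto (fun y => x + x - y) (𝓝 x) (𝓝 x) := by
    have : Continuous fun y : E => x + x - y := by fun_prop
    simpa using this.tendsto x
  have hV : W ∩ U ∩ (fun y => x + x - y) ⁻¹' U ∈ 𝓝 x :=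
    inter_mem (inter_mem hW (hU.mem_nhds hx)) (hc (hU.mem_nhds hx))
  obtain ⟨V, hVs, hVo, hxV⟩ := mem_nhds_iff.1 hV
  obtain ⟨y, hyV, hy⟩ := (Measure.dense_of_ae (hQ.and hQ')).inter_open_nonempty V hVo ⟨x, hxV⟩
  obtain ⟨⟨h1, h2⟩, h3⟩ := hVs hyV
  exact ⟨y, h1, h2, h3, hy.1 h2, hy.2 h3⟩

/-- Convex functions on an open set that are uniformly bounded below and converge almost everywhere
converge everywhere, to a convex function. -/
lemma _root_.ConvexOn.exists_tendsto_of_ae_tendsto {E : Type*} [NormedAddCommGroup E]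
    [NormedSpace ℝ E] [FiniteDimensional ℝ E] [MeasurableSpace E] [BorelSpace E] (ν : Measure E)
    [ν.IsAddHaarMeasure] {U : Set E} (hU : IsOpen U) {f : ℕ → E → ℝ}
    (hf : ∀ k, ConvexOn ℝ U (f k)) {C : ℝ} (hC : ∀ k, ∀ x ∈ U, -C ≤ f k x) {F : E → ℝ}
    (hF : ∀ᵐ x ∂ν.restrict U, Tendsto (fun k => f k x) atTop (𝓝 (F x))) :
    ∃ g : E → ℝ, ConvexOn ℝ U g ∧ ∀ x ∈ U, Tendsto (fun k => f k x) atTop (𝓝 (g x)) := by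
  have hmid : ∀ k, ∀ x y, y ∈ U → x + x - y ∈ U → 2 * f k x ≤ f k y + f k (x + x - y) := by
    intro k x y hy hz
    have h := (hf k).2 hy hz (by norm_num : (0 : ℝ) ≤ 1 / 2) (by norm_num : (0 : ℝ) ≤ 1 / 2)
      (by norm_num)
    have e : (1 / 2 : ℝ) • y + (1 / 2 : ℝ) • (x + x - y) = x := by module
    rw [e, smul_eq_mul, smul_eq_mul] at h
    linarith
  have hbelow : ∀ x ∈ U, IsBoundedUnder (· ≥ ·) atTop fun k => f k x := fun x hx =>
    isBoundedUnder_of ⟨-C, fun k => hC k x hx⟩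
  have habove : ∀ x ∈ U, IsBoundedUnder (· ≤ ·) atTop fun k => f k x := by
    intro x hx
    obtain ⟨y, -, hy, hz, hFy, hFz⟩ := exists_symmetric_of_ae_restrict ν hU hF hx univ_mem
    obtain ⟨b, hb⟩ := (hFy.add hFz).isBoundedUnder_le
    refine ⟨b / 2, ?_⟩
    rw [eventually_map] at hb ⊢
    filter_upwards [hb] with k hk
    linarith [hmid k x y hy hz]
  let g : E → ℝ := fun x => limsup (fun k => f k x) atTop
  have hlt : ∀ x ∈ U, ∀ c, g x < c → ∀ᶠ k in atTop, f k x < c := fun x hx c hc =>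
    eventually_lt_of_limsup_lt hc (habove x hx)
  have hg : ConvexOn ℝ U g := by
    refine ⟨(hf 0).1, fun x hx y hy a b ha hb hab => ?_⟩
    refine le_of_forall_pos_le_add fun ε hε => ?_
    refine limsup_le_of_le ((hbelow _ ((hf 0).1 hx hy ha hb hab)).isCoboundedUnder_le) ?_
    filter_upwards [hlt x hx (g x + ε) (by linarith), hlt y hy (g y + ε) (by linarith)]
      with k hkx hky
    calc f k (a • x + b • y) ≤ a * f k x + b * f k y := (hf k).2 hx hy ha hb hab
      _ ≤ a * (g x + ε) + b * (g y + ε) := by gcongr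
      _ = a • g x + b • g y + ε := by
        simp only [smul_eq_mul]
        linear_combination ε * hab
  have hgc : ContinuousOn g U := hg.continuousOn hU
  refine ⟨g, hg, fun x hx => tendsto_order.2 ⟨fun c hc => ?_, fun c hc => hlt x hx c hc⟩⟩
  -- A good point `y` near `x` bounds `f k x` below by `2 f k y - f k (2 y - x)`.
  obtain ⟨ε, hε, hεc⟩ : ∃ ε : ℝ, 0 < ε ∧ c = g x - 3 * ε := ⟨(g x - c) / 3, by linarith, by ring⟩
  have hmaps : Tendsto (fun y => y + y - x) (𝓝 x) (𝓝 x) := by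
    have : Continuous fun y : E => y + y - x := by fun_prop
    simpa using this.tendsto x
  have hgx : Tendsto (fun y => 2 * g y - g (y + y - x)) (𝓝 x) (𝓝 (2 * g x - g x)) := by
    have h1 : Tendsto g (𝓝 x) (𝓝 (g x)) := (hgc.continuousAt (hU.mem_nhds hx)).tendsto
    exact (h1.const_mul 2).sub (h1.comp hmaps)
  have hW : {y | g x - ε < 2 * g y - g (y + y - x) ∧ y + y - x ∈ U} ∈ 𝓝 x :=
    (hgx.eventually_const_lt (by linarith)).and (hmaps (hU.mem_nhds hx))
  obtain ⟨y, ⟨hy1, hy2⟩, hyU, -, hFy, -⟩ := exists_symmetric_of_ae_restrict ν hU hF hx hW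
  have hgy : g y = F y := hFy.limsup_eq
  filter_upwards [hFy.eventually_const_lt (by linarith : g y - ε / 2 < F y),
    hlt _ hy2 (g (y + y - x) + ε) (by linarith)] with k hk1 hk2
  have := hmid k y (y + y - x) hy2 (by simpa using hx)
  have e : y + y - (y + y - x) = x := by abel
  rw [e] at this
  linarith

/-! ### Continuity on the polytope with its facets -/

/-- A convex function on `P*` is upper semicontinuous, so lower semicontinuity makes it
continuous. -/
lemma continuousOn_star {Φ : EuclideanSpace ℝ (Fin n) → ℝ} (hΦ : ConvexOn ℝ P.star Φ)
    (hlsc : LowerSemicontinuousOn Φ P.star) : ContinuousOn Φ P.star := by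
  have hint : ContinuousOn Φ P.interiorSet :=
    (hΦ.subset P.interiorSet_subset_star P.convex_interiorSet).continuousOn P.isOpen_interiorSet
  intro x hx
  rcases hx with hxi | hxf
  · exact (hint.continuousAt (P.isOpen_interiorSet.mem_nhds hxi)).continuousWithinAt
  have hx : x ∈ P.star := Or.inr hxf
  obtain ⟨k, hxk⟩ := mem_iUnion.1 hxf
  refine tendsto_order.2 ⟨fun c hc => hlsc x hx c hc, fun c hc => ?_⟩
  obtain ⟨p, hp⟩ := P.exists_mem_interiorSet
  have hpk := hp k
  -- `τ` measures the distance to the facet, `π` projects to its hyperplane along `p - x`.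
  set τ : EuclideanSpace ℝ (Fin n) → ℝ := fun u => P.δ k u / P.δ k p with hτ
  set π : EuclideanSpace ℝ (Fin n) → EuclideanSpace ℝ (Fin n) := fun u => u - τ u • (p - x) with hπ
  have hτc : Continuous τ := (P.continuous_δ k).div_const _
  have hπc : Continuous π := by fun_prop
  have hτx : τ x = 0 := by rw [hτ]; simp [hxk.1]
  have hδπ : ∀ u, P.δ k (π u) = 0 := by
    intro u
    have h1 : P.δ k (π u) = P.δ k u - τ u * (P.δ k p - P.δ k x) := by
      simp only [hπ, δ_eq_inner, inner_sub_right, inner_smul_right]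
      ring
    rw [h1, hxk.1, hτ]
    field_simp
    ring
  have hπfix : ∀ u, P.δ k u = 0 → π u = u := fun u hu => by simp [hπ, hτ, hu]
  have hπcombo : ∀ u v (a b : ℝ), a + b = 1 → π (a • u + b • v) = a • π u + b • π v := by
    intro u v a b hab
    have : τ (a • u + b • v) = a * τ u + b * τ v := by
      simp only [hτ, P.δ_combo k u v hab]
      ring
    simp only [hπ, this]
    module
  set O : Set (EuclideanSpace ℝ (Fin n)) := {u | ∀ j, j ≠ k → 0 < P.δ j (π u)} with hO
  have hOo : IsOpen O := by
    have : O = ⋂ j, {u | j ≠ k → 0 < P.δ j (π u)} := by ext; simp [hO]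
    rw [this]
    refine isOpen_iInter_of_finite fun j => ?_
    by_cases hj : j = k
    · simp [hj]
    · simpa [hj] using isOpen_lt continuous_const ((P.continuous_δ j).comp hπc)
  have hOm : ∀ u ∈ O, π u ∈ P.star := fun u hu => P.facet_subset_star k ⟨hδπ u, hu⟩
  have hOconv : Convex ℝ O := by
    intro u hu v hv a b ha hb hab j hj
    rw [hπcombo u v a b hab, P.δ_combo _ _ _ hab]
    rcases ha.eq_or_lt with rfl | ha
    · rw [zero_add] at hab
      simpa [hab] using hv j hj
    · exact add_pos_of_pos_of_nonneg (mul_pos ha (hu j hj)) (mul_nonneg hb (hv j hj).le)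
  have hcvx : ConvexOn ℝ O (Φ ∘ π) := by
    refine ⟨hOconv, fun u hu v hv a b ha hb hab => ?_⟩
    simp only [Function.comp, hπcombo u v a b hab]
    exact hΦ.2 (hOm u hu) (hOm v hv) ha hb hab
  have hxO : x ∈ O := fun j hj => by
    rw [hπfix x hxk.1]
    exact hxk.2 j hj
  have hΦπ : Tendsto (Φ ∘ π) (𝓝 x) (𝓝 (Φ x)) := by
    have := ((hcvx.continuousOn hOo).continuousAt (hOo.mem_nhds hxO)).tendsto
    simpa [Function.comp, hπfix x hxk.1] using this
  -- A point `y` of `P*` near `x` is on the segment from a point `z y` of the facet to `p`.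
  set z : EuclideanSpace ℝ (Fin n) → EuclideanSpace ℝ (Fin n) :=
    fun y => (1 - τ y)⁻¹ • (y - τ y • p) with hz
  have hzt : Tendsto z (𝓝 x) (𝓝 x) := by
    have h1 : Tendsto (fun y => (1 - τ y)⁻¹) (𝓝 x) (𝓝 (1 - τ x)⁻¹) :=
      ((continuous_const.sub hτc).tendsto x).inv₀ (by simp [hτx])
    have h2 : Tendsto (fun y => y - τ y • p) (𝓝 x) (𝓝 (x - τ x • p)) :=
      (by fun_prop : Continuous fun y => y - τ y • p).tendsto x
    simpa [hτx] using h1.smul h2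
  have hlim : Tendsto (fun y => (1 - τ y) * (Φ ∘ π) (z y) + τ y * Φ p) (𝓝 x) (𝓝 (Φ x)) := by
    have h0 : Tendsto (fun y => 1 - τ y) (𝓝 x) (𝓝 (1 - τ x)) :=
      (continuous_const.sub hτc).tendsto x
    have h1 := (h0.mul (hΦπ.comp hzt)).add
      ((hτc.tendsto x).mul_const (Φ p))
    simpa [hτx] using h1
  have hτ1 : ∀ᶠ y in 𝓝 x, τ y < 1 := (hτc.tendsto x).eventually_lt_const (by simp [hτx])
  filter_upwards [nhdsWithin_le_nhds (hlim.eventually_lt_const hc),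
    nhdsWithin_le_nhds (hzt (hOo.mem_nhds hxO)), nhdsWithin_le_nhds hτ1, self_mem_nhdsWithin]
    with y hy1 hy2 hy3 hy4
  have h1τ : 1 - τ y ≠ 0 := by linarith
  have hyz : y = (1 - τ y) • z y + τ y • p := by
    simp only [hz, smul_smul, mul_inv_cancel₀ h1τ]
    module
  have hzk : P.δ k (z y) = 0 := by
    have h1 := P.δ_combo k (z y) p (by ring : (1 - τ y) + τ y = 1)
    rw [← hyz] at h1
    have h2 : τ y * P.δ k p = P.δ k y := by simp only [hτ]; field_simp
    have h3 : (1 - τ y) * P.δ k (z y) = 0 := by linarith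
    exact (mul_eq_zero.1 h3).resolve_left h1τ
  have hzs : z y ∈ P.star := by
    have := hOm _ hy2
    rwa [hπfix _ hzk] at this
  have hτ0 : 0 ≤ τ y := div_nonneg ((P.mem_star_iff.1 hy4).1 k) hpk.le
  have hle := hΦ.2 hzs (P.interiorSet_subset_star hp) (by linarith : 0 ≤ 1 - τ y) hτ0 (by ring)
  rw [← hyz] at hle
  simp only [Function.comp, hπfix _ hzk] at hy1
  exact hle.trans_lt hy1

/-! ### Limits of sequences in the cone -/

lemma aestronglyMeasurable_σ {f : EuclideanSpace ℝ (Fin n) → ℝ} (hf : ContinuousOn f P.star) :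
    AEStronglyMeasurable f P.σ := by
  rw [← Measure.restrict_eq_self_of_ae_mem P.ae_σ_mem_star]
  exact hf.aestronglyMeasurable P.measurableSet_star

/-- Lower semicontinuity of the boundary integral. If functions of `𝓒₁ ∩ L²` converge in `L²` and
their boundary integrals converge to `ℓ`, then the limit is represented by a function of
`𝓒₁ ∩ L²` whose boundary integral is at most `ℓ`.

On the interior the representative is the pointwise limit `g` of a subsequence. Its value at a point
`x` of `P*` is the supremum over `t` of `(g ((1 - t) x + t p) - t g p) / (1 - t)`, where `p` is a
fixed interior point: a supremum of continuous convex functions which, by convexity, is below the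
lower limit of the values of the sequence at `x`. -/
lemma exists_memC1L2_of_tendsto {f : ℕ → EuclideanSpace ℝ (Fin n) → ℝ}
    (hf : ∀ k, P.MemC1L2 (f k)) {F : EuclideanSpace ℝ (Fin n) → ℝ} (hF : MemLp F 2 P.μ)
    (hlim : Tendsto (fun k => eLpNorm (f k - F) 2 P.μ) atTop (𝓝 0)) {ℓ : ℝ}
    (hℓ : Tendsto (fun k => ∫ x, f k x ∂P.σ) atTop (𝓝 ℓ)) {C : ℝ}
    (hC : ∀ k, ∀ x ∈ P.star, -C ≤ f k x) :
    ∃ Φ, P.MemC1L2 Φ ∧ Φ =ᵐ[P.μ] F ∧ ∫ x, Φ x ∂P.σ ≤ ℓ := by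
  obtain ⟨ns, hns, hae⟩ := (tendstoInMeasure_of_tendsto_eLpNorm two_ne_zero
    (fun k => (hf k).2.aestronglyMeasurable) hF.aestronglyMeasurable hlim).exists_seq_tendsto_ae
  have hsub := P.interiorSet_subset_star
  obtain ⟨g, hg, hgt⟩ := ConvexOn.exists_tendsto_of_ae_tendsto volume P.isOpen_interiorSet
    (fun k => (hf (ns k)).1.convexOn.subset hsub P.convex_interiorSet)
    (fun k x hx => hC (ns k) x (hsub hx)) hae
  have hgc : ContinuousOn g P.interiorSet := hg.continuousOn P.isOpen_interiorSet
  obtain ⟨p, hp⟩ := P.exists_mem_interiorSet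
  let c : ℝ → EuclideanSpace ℝ (Fin n) → EuclideanSpace ℝ (Fin n) := fun t x =>
    (1 - t) • x + t • p
  have hc : ∀ t ∈ Ioo (0 : ℝ) 1, ∀ x ∈ P.star, c t x ∈ P.interiorSet := fun t ht x hx =>
    P.combo_mem_interiorSet hx hp ht.1 ht.2.le
  let φ : ℝ → EuclideanSpace ℝ (Fin n) → ℝ := fun t x => (g (c t x) - t * g p) / (1 - t)
  have hφ_cvx : ∀ t ∈ Ioo (0 : ℝ) 1, ConvexOn ℝ P.star (φ t) := by
    intro t ht
    refine ⟨P.convex_star, fun x hx y hy a b ha hb hab => ?_⟩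
    have h1 : c t (a • x + b • y) = a • c t x + b • c t y := by
      have h0 : t • p = (a + b) • t • p := by rw [hab, one_smul]
      calc c t (a • x + b • y) = (1 - t) • (a • x + b • y) + (a + b) • t • p := by rw [← h0]
        _ = a • c t x + b • c t y := by
          simp only [c]
          module
    have h2 := hg.2 (hc t ht x hx) (hc t ht y hy) ha hb hab
    have h3 : 0 < 1 - t := by linarith [ht.2]
    simp only [φ, smul_eq_mul, h1] at h2 ⊢
    rw [← mul_div_assoc, ← mul_div_assoc, ← add_div]
    refine div_le_div_of_nonneg_right ?_ h3.le
    have h4 : t * g p = (a + b) * (t * g p) := by rw [hab, one_mul]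
    linarith
  have hφ_cont : ∀ t ∈ Ioo (0 : ℝ) 1, ContinuousOn (φ t) P.star := by
    intro t ht
    have h1 : ContinuousOn (fun x => g (c t x)) P.star :=
      hgc.comp (by fun_prop) fun x hx => hc t ht x hx
    exact (h1.sub continuousOn_const).div_const _
  -- Applied to `h = g` on the interior, and to the members of the sequence on all of `P*`.
  have hφ_le : ∀ t ∈ Ioo (0 : ℝ) 1, ∀ h : EuclideanSpace ℝ (Fin n) → ℝ, ∀ s, ConvexOn ℝ s h →
      p ∈ s → ∀ x ∈ s, (h (c t x) - t * h p) / (1 - t) ≤ h x := by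
    intro t ht h s hh hps x hx
    have h3 : 0 < 1 - t := by linarith [ht.2]
    have := hh.2 hx hps h3.le ht.1.le (by ring)
    rw [div_le_iff₀ h3]
    simp only [smul_eq_mul] at this
    simp only [c]
    linarith
  obtain ⟨D, hCD, hD⟩ : ∃ D, C ≤ D ∧ 2 * C + g p ≤ D :=
    ⟨max C (2 * C + g p), le_max_left _ _, le_max_right _ _⟩
  let G : EuclideanSpace ℝ (Fin n) → ℝ≥0∞ := fun x =>
    liminf (fun k => ENNReal.ofReal (f (ns k) x + D)) atTop
  have hφG : ∀ t ∈ Ioo (0 : ℝ) 1, ∀ x ∈ P.star, ENNReal.ofReal (φ t x + D) ≤ G x := by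
    intro t ht x hx
    have h1 : Tendsto (fun k => ENNReal.ofReal
        ((f (ns k) (c t x) - t * f (ns k) p) / (1 - t) + D)) atTop
        (𝓝 (ENNReal.ofReal (φ t x + D))) :=
      ENNReal.tendsto_ofReal ((((hgt _ (hc t ht x hx)).sub
        ((hgt p hp).const_mul t)).div_const _).add_const D)
    rw [← h1.liminf_eq]
    refine liminf_le_liminf (Eventually.of_forall fun k => ENNReal.ofReal_le_ofReal ?_)
    exact add_le_add (hφ_le t ht _ _ (hf (ns k)).1.convexOn (hsub hp) x hx) le_rfl
  have hGint : ∫⁻ x, G x ∂P.σ ≤ ENNReal.ofReal (ℓ + D * P.σ.real univ) := by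
    refine (lintegral_liminf_le' fun k =>
      ((hf (ns k)).1.integrable.aemeasurable.add_const D).ennreal_ofReal).trans ?_
    have h1 : ∀ k, ∫⁻ x, ENNReal.ofReal (f (ns k) x + D) ∂P.σ
        = ENNReal.ofReal (∫ x, f (ns k) x ∂P.σ + D * P.σ.real univ) := by
      intro k
      have h2 : Integrable (fun x => f (ns k) x + D) P.σ :=
        (hf (ns k)).1.integrable.add (integrable_const D)
      rw [← ofReal_integral_eq_lintegral_ofReal h2,
        integral_add (hf (ns k)).1.integrable (integrable_const D), integral_const, smul_eq_mul,
        mul_comm D]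
      filter_upwards [P.ae_σ_mem_star] with x hx
      have := hC (ns k) x hx
      change 0 ≤ f (ns k) x + D
      linarith
    simp only [h1]
    exact (ENNReal.tendsto_ofReal
      ((hℓ.comp hns.tendsto_atTop).add_const _)).liminf_eq.le
  have hℓ0 : 0 ≤ ℓ + D * P.σ.real univ := by
    refine ge_of_tendsto (hℓ.add_const _) (Eventually.of_forall fun k => ?_)
    have h1 : ∫ _, -C ∂P.σ ≤ ∫ x, f k x ∂P.σ := by
      refine integral_mono_ae (integrable_const _) (hf k).1.integrable ?_
      filter_upwards [P.ae_σ_mem_star] with x hx using hC k x hx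
    rw [integral_const, smul_eq_mul] at h1
    have := mul_le_mul_of_nonneg_right hCD (measureReal_nonneg (μ := P.σ) (s := univ))
    linarith
  have hGfin : ∀ᵐ x ∂P.σ, G x < ∞ := by
    have h : ∀ k, AEMeasurable (fun x => ENNReal.ofReal (f (ns k) x + D)) P.σ := fun k =>
      ((hf (ns k)).1.integrable.aemeasurable.add_const D).ennreal_ofReal
    refine ae_lt_top' ⟨fun x => liminf (fun k => (h k).mk _ x) atTop,
      .liminf fun k => (h k).measurable_mk, ?_⟩ (hGint.trans_lt ENNReal.ofReal_lt_top).ne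
    filter_upwards [ae_all_iff.2 fun k => (h k).ae_eq_mk] with x hx
    simp only [G, hx]
  have hφG' : ∀ x ∈ P.star, G x < ∞ → ∀ t ∈ Ioo (0 : ℝ) 1, φ t x ≤ (G x).toReal - D := by
    intro x hx hGx t ht
    have := (ENNReal.ofReal_le_iff_le_toReal hGx.ne).1 (hφG t ht x hx)
    linarith
  have hbdd : ∀ x ∈ P.star, BddAbove (range fun t : Ioo (0 : ℝ) 1 => φ t x) := by
    rintro x (hx | hx)
    · exact ⟨g x, by rintro _ ⟨t, rfl⟩; exact hφ_le t t.2 g _ hg hp x hx⟩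
    · obtain ⟨k, hk⟩ := mem_iUnion.1 hx
      obtain ⟨y, hy, z, hz, hxyz, hGy, hGz⟩ := P.exists_symmetric_of_ae_σ hGfin hk
      refine ⟨(1 / 2) * ((G y).toReal - D) + (1 / 2) * ((G z).toReal - D), ?_⟩
      rintro _ ⟨t, rfl⟩
      have := (hφ_cvx t t.2).2 hy hz (by norm_num : (0 : ℝ) ≤ 1 / 2)
        (by norm_num : (0 : ℝ) ≤ 1 / 2) (by norm_num)
      rw [← hxyz] at this
      refine this.trans ?_
      simp only [smul_eq_mul]
      gcongr
      · exact hφG' y hy hGy t t.2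
      · exact hφG' z hz hGz t t.2
  have : Nonempty (Ioo (0 : ℝ) 1) := ⟨⟨1 / 2, by norm_num, by norm_num⟩⟩
  let Φ : EuclideanSpace ℝ (Fin n) → ℝ := fun x => ⨆ t : Ioo (0 : ℝ) 1, φ t x
  have hΦ_ge : ∀ x ∈ P.star, ∀ t ∈ Ioo (0 : ℝ) 1, φ t x ≤ Φ x := fun x hx t ht =>
    le_ciSup (hbdd x hx) ⟨t, ht⟩
  have hΦ_cvx : ConvexOn ℝ P.star Φ := by
    refine ⟨P.convex_star, fun x hx y hy a b ha hb hab => ciSup_le fun t => ?_⟩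
    refine ((hφ_cvx t t.2).2 hx hy ha hb hab).trans ?_
    simp only [smul_eq_mul]
    gcongr
    · exact hΦ_ge x hx t t.2
    · exact hΦ_ge y hy t t.2
  have hΦ_cont : ContinuousOn Φ P.star := P.continuousOn_star hΦ_cvx
    (lowerSemicontinuousOn_ciSup hbdd fun t => (hφ_cont t t.2).lowerSemicontinuousOn)
  have hΦg : ∀ x ∈ P.interiorSet, Φ x = g x := by
    intro x hx
    refine le_antisymm (ciSup_le fun t => hφ_le t t.2 g _ hg hp x hx) ?_
    have h1 : Tendsto (fun t => g (c t x)) (𝓝[>] 0) (𝓝 (g x)) :=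
      (hgc.continuousAt (P.isOpen_interiorSet.mem_nhds hx)).tendsto.comp (tendsto_combo x p)
    have h2 : Tendsto (fun t : ℝ => t) (𝓝[>] 0) (𝓝 0) := nhdsWithin_le_nhds
    have h3 : Tendsto (fun t => φ t x) (𝓝[>] 0) (𝓝 ((g x - 0 * g p) / (1 - 0))) :=
      (h1.sub (h2.mul_const _)).div (tendsto_const_nhds.sub h2) (by norm_num)
    simp only [zero_mul, sub_zero, div_one] at h3
    refine le_of_tendsto h3 ?_
    filter_upwards [Ioo_mem_nhdsGT (zero_lt_one' ℝ)] with t ht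
    exact hΦ_ge x (hsub hx) t ht
  have hΦF : Φ =ᵐ[P.μ] F := by
    filter_upwards [hae, P.ae_μ_mem_interiorSet] with x hx1 hx2
    rw [hΦg x hx2]
    exact tendsto_nhds_unique (hgt x hx2) hx1
  have hΦD : ∀ x ∈ P.star, 0 ≤ Φ x + D := by
    intro x hx
    have ht : (1 / 2 : ℝ) ∈ Ioo (0 : ℝ) 1 := ⟨by norm_num, by norm_num⟩
    have h1 := hΦ_ge x hx _ ht
    have h2 : -C ≤ g (c (1 / 2) x) := ge_of_tendsto (hgt _ (hc _ ht x hx))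
      (Eventually.of_forall fun k => hC _ _ (hsub (hc _ ht x hx)))
    have h3 : φ (1 / 2) x = 2 * g (c (1 / 2) x) - g p := by
      simp only [φ]
      ring
    linarith
  have hΦD_ae : 0 ≤ᵐ[P.σ] fun x => Φ x + D := by
    filter_upwards [P.ae_σ_mem_star] with x hx using hΦD x hx
  have hΦ_lint : ∫⁻ x, ENNReal.ofReal (Φ x + D) ∂P.σ ≤ ENNReal.ofReal (ℓ + D * P.σ.real univ) := by
    refine (lintegral_mono_ae ?_).trans hGint
    filter_upwards [P.ae_σ_mem_star] with x hx
    by_cases hGx : G x = ∞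
    · rw [hGx]
      exact le_top
    · refine (ENNReal.ofReal_le_iff_le_toReal hGx).2 ?_
      have : Φ x ≤ (G x).toReal - D := ciSup_le fun t => hφG' x hx (lt_top_iff_ne_top.2 hGx) t t.2
      linarith
  have hΦDi : Integrable (fun x => Φ x + D) P.σ := by
    refine ⟨(P.aestronglyMeasurable_σ hΦ_cont).add aestronglyMeasurable_const, ?_⟩
    rw [hasFiniteIntegral_iff_ofReal hΦD_ae]
    exact hΦ_lint.trans_lt ENNReal.ofReal_lt_top
  have hΦi : Integrable Φ P.σ :=
    (hΦDi.sub (integrable_const D)).congr (Eventually.of_forall fun x => add_sub_cancel_right _ _)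
  refine ⟨Φ, ⟨⟨hΦ_cvx, hΦ_cont, hΦi⟩, hF.ae_eq hΦF.symm⟩, hΦF, ?_⟩
  rw [← ofReal_integral_eq_lintegral_ofReal hΦDi hΦD_ae, ENNReal.ofReal_le_ofReal_iff hℓ0,
    integral_add hΦi (integrable_const D), integral_const, smul_eq_mul] at hΦ_lint
  linarith

end MomentPolytope

namespace MomentPolytope

variable {n : ℕ} {P : MomentPolytope n} {f g : EuclideanSpace ℝ (Fin n) → ℝ}

/-! ### The cone `𝓒₁ ∩ L²` and the functional on it -/

lemma MemC1L2.congr (hf : P.MemC1L2 f) (h : EqOn f g P.star) : P.MemC1L2 g := by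
  refine ⟨⟨hf.1.convexOn.congr h, hf.1.continuousOn.congr h.symm, hf.1.integrable.congr ?_⟩,
    hf.2.ae_eq ?_⟩
  · filter_upwards [P.ae_σ_mem_star] with x hx using h hx
  · filter_upwards [P.ae_μ_mem_interiorSet] with x hx using h (P.interiorSet_subset_star hx)

lemma MemC1L2.add (hf : P.MemC1L2 f) (hg : P.MemC1L2 g) : P.MemC1L2 (f + g) :=
  ⟨⟨hf.1.convexOn.add hg.1.convexOn, hf.1.continuousOn.add hg.1.continuousOn,
    hf.1.integrable.add hg.1.integrable⟩, hf.2.add hg.2⟩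

lemma MemC1L2.const_smul (hf : P.MemC1L2 f) {c : ℝ} (hc : 0 ≤ c) : P.MemC1L2 (c • f) :=
  ⟨⟨hf.1.convexOn.smul hc, hf.1.continuousOn.const_smul c, hf.1.integrable.smul c⟩,
    hf.2.const_smul c⟩

lemma eqOn_star_of_ae_eq (hf : ContinuousOn f P.star) (hg : ContinuousOn g P.star)
    (h : f =ᵐ[P.μ] g) : EqOn f g P.star :=
  (Measure.eqOn_open_of_ae_eq h P.isOpen_interiorSet (hf.mono P.interiorSet_subset_star)
    (hg.mono P.interiorSet_subset_star)).of_subset_closure hf hg P.interiorSet_subset_star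
    P.star_subset_closure

lemma L_eq (f : EuclideanSpace ℝ (Fin n) → ℝ) :
    P.L f = ∫ x, f x ∂P.σ - P.Shat * ∫ x, f x ∂P.μ := by
  rw [L, L_, integral_const_mul]

lemma L_congr (h : EqOn f g P.star) : P.L f = P.L g := by
  have h1 : ∫ x, f x ∂P.σ = ∫ x, g x ∂P.σ := integral_congr_ae <| by
    filter_upwards [P.ae_σ_mem_star] with x hx using h hx
  have h2 : ∫ x, f x ∂P.μ = ∫ x, g x ∂P.μ := integral_congr_ae <| by
    filter_upwards [P.ae_μ_mem_interiorSet] with x hx using h (P.interiorSet_subset_star hx)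
  rw [L_eq, L_eq, h1, h2]

lemma MemC1L2.integrable_μ (hf : P.MemC1L2 f) : Integrable f P.μ := hf.2.integrable one_le_two

lemma L_add (hf : P.MemC1L2 f) (hg : P.MemC1L2 g) : P.L (f + g) = P.L f + P.L g := by
  rw [L_eq, L_eq, L_eq, integral_add' hf.1.integrable hg.1.integrable,
    integral_add' hf.integrable_μ hg.integrable_μ]
  ring

lemma L_smul (c : ℝ) (f : EuclideanSpace ℝ (Fin n) → ℝ) : P.L (c • f) = c * P.L f := by
  simp only [L_eq, Pi.smul_apply, smul_eq_mul, integral_const_mul]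
  ring

lemma inner_toLp (hf : MemLp f 2 P.μ) (hg : MemLp g 2 P.μ) :
    inner ℝ (hf.toLp f) (hg.toLp g) = ∫ x, f x * g x ∂P.μ := by
  rw [L2.inner_def]
  refine integral_congr_ae ?_
  filter_upwards [hf.coeFn_toLp, hg.coeFn_toLp] with x h1 h2
  rw [h1, h2]
  simp [mul_comm]

lemma normL2_eq (hf : MemLp f 2 P.μ) : P.normL2 f = ‖hf.toLp f‖ := by
  rw [normL2, ← toReal_eLpNorm hf.aestronglyMeasurable, Lp.norm_toLp]

lemma normL2_nonneg (P : MomentPolytope n) (f : EuclideanSpace ℝ (Fin n) → ℝ) : 0 ≤ P.normL2 f :=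
  lpNorm_nonneg

lemma integral_eq_inner_one (hf : MemLp f 2 P.μ) :
    ∫ x, f x ∂P.μ = inner ℝ ((memLp_const (1 : ℝ)).toLp fun _ => (1 : ℝ)) (hf.toLp f) := by
  rw [inner_toLp]
  simp

lemma integral_abs_le (P : MomentPolytope n) : ∃ C : ℝ, 0 ≤ C ∧ ∀ f, MemLp f 2 P.μ →
    ∫ x, |f x| ∂P.μ ≤ C * P.normL2 f := by
  refine ⟨_, norm_nonneg ((memLp_const (μ := P.μ) (p := 2) (1 : ℝ)).toLp fun _ => (1 : ℝ)),
    fun f hf => ?_⟩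
  have h1 : P.normL2 f = P.normL2 fun x => |f x| := (lpNorm_fun_abs hf.aestronglyMeasurable 2).symm
  have h2 : MemLp (fun x => |f x|) 2 P.μ := hf.abs
  rw [h1, normL2_eq h2, integral_eq_inner_one h2]
  exact real_inner_le_norm _ _

lemma L_sub_eq_add_inner {Φ : EuclideanSpace ℝ (Fin n) → ℝ} (hΦ : MemLp Φ 2 P.μ)
    (hf : P.MemC1L2 f) :
    P.L_ (fun x => P.Shat - Φ x) f = P.L f + inner ℝ (hΦ.toLp Φ) (hf.2.toLp f) := by
  have h1 : Integrable (fun x => Φ x * f x) P.μ := hΦ.integrable_mul hf.2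
  have h2 : ∫ x, (P.Shat - Φ x) * f x ∂P.μ = P.Shat * ∫ x, f x ∂P.μ - ∫ x, Φ x * f x ∂P.μ := by
    rw [← integral_const_mul, ← integral_sub (hf.integrable_μ.const_mul _) h1]
    simp only [sub_mul]
  rw [L_eq, L_, h2, inner_toLp]
  ring

/-! ### Minimising the quadratic functional -/

/-- The strictly convex functional `½ ‖f‖² + 𝓛(f)`, whose minimiser over `𝓒₁ ∩ L²` is the
normalised minimiser of `W`. -/
noncomputable def energy (P : MomentPolytope n) (f : EuclideanSpace ℝ (Fin n) → ℝ) : ℝ :=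
  P.normL2 f ^ 2 / 2 + P.L f

lemma energy_eq (hf : P.MemC1L2 f) : P.energy f = ‖hf.2.toLp f‖ ^ 2 / 2 + P.L f := by
  rw [energy, normL2_eq hf.2]

/-- On `𝓒₁ ∩ L²`, functions are bounded below by a multiple of their `L²` norm. -/
lemma exists_lower_bound_normL2 (P : MomentPolytope n) : ∃ C : ℝ, 0 ≤ C ∧ ∀ f, P.MemC1L2 f →
    ∀ x ∈ P.star, -(C * P.normL2 f) ≤ f x := by
  obtain ⟨C₁, hC₁, h₁⟩ := P.exists_lower_bound
  obtain ⟨C₂, hC₂, h₂⟩ := integral_abs_le P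
  refine ⟨C₁ * C₂, by positivity, fun f hf x hx => ?_⟩
  have h3 := h₁ f hf.1.convexOn hf.integrable_μ x hx
  have h4 := mul_le_mul_of_nonneg_left (h₂ f hf.2) hC₁
  linarith

lemma exists_lower_bound_L (P : MomentPolytope n) : ∃ C : ℝ, ∀ f, P.MemC1L2 f →
    -(C * P.normL2 f) ≤ P.L f := by
  obtain ⟨C₁, hC₁, h₁⟩ := exists_lower_bound_normL2 P
  obtain ⟨C₂, hC₂, h₂⟩ := integral_abs_le P
  refine ⟨P.σ.real univ * C₁ + |P.Shat| * C₂, fun f hf => ?_⟩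
  have h3 : ∫ _, -(C₁ * P.normL2 f) ∂P.σ ≤ ∫ x, f x ∂P.σ := by
    refine integral_mono_ae (integrable_const _) hf.1.integrable ?_
    filter_upwards [P.ae_σ_mem_star] with x hx using h₁ f hf x hx
  rw [integral_const, smul_eq_mul] at h3
  have h4 : P.Shat * ∫ x, f x ∂P.μ ≤ |P.Shat| * (C₂ * P.normL2 f) := by
    refine (le_abs_self _).trans ?_
    rw [abs_mul]
    exact mul_le_mul_of_nonneg_left (abs_integral_le_integral_abs.trans (h₂ f hf.2))
      (abs_nonneg _)
  rw [L_eq]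
  linarith

lemma exists_lower_bound_energy (P : MomentPolytope n) :
    ∃ m : ℝ, ∀ f, P.MemC1L2 f → m ≤ P.energy f := by
  obtain ⟨C, hC⟩ := exists_lower_bound_L P
  refine ⟨-(C ^ 2 / 2), fun f hf => ?_⟩
  have := hC f hf
  have := sq_nonneg (P.normL2 f - C)
  rw [energy]
  linarith

/-- Strict convexity of the energy, in the quantitative form of the parallelogram law. -/
lemma energy_midpoint (hf : P.MemC1L2 f) (hg : P.MemC1L2 g) :
    P.energy ((1 / 2 : ℝ) • f + (1 / 2 : ℝ) • g)
      = (P.energy f + P.energy g) / 2 - ‖hf.2.toLp f - hg.2.toLp g‖ ^ 2 / 8 := by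
  have hf' := hf.const_smul (by norm_num : (0 : ℝ) ≤ 1 / 2)
  have hg' := hg.const_smul (by norm_num : (0 : ℝ) ≤ 1 / 2)
  have h1 : (hf'.add hg').2.toLp _ = (1 / 2 : ℝ) • (hf.2.toLp f + hg.2.toLp g) := by
    rw [smul_add]
    rfl
  have h2 := parallelogram_law_with_norm ℝ (hf.2.toLp f) (hg.2.toLp g)
  rw [energy_eq (hf'.add hg'), energy_eq hf, energy_eq hg, L_add hf' hg', L_smul, L_smul, h1,
    norm_smul, mul_pow, Real.norm_of_nonneg (by norm_num)]
  linarith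

/-- The direct method: a minimising sequence of the energy is Cauchy in `L²`, and its limit is again
in the cone. -/
lemma exists_energy_minimiser {f₀ : EuclideanSpace ℝ (Fin n) → ℝ} (hf₀ : P.MemC1L2 f₀) :
    ∃ Φ, P.MemC1L2 Φ ∧ ∀ f, P.MemC1L2 f → P.energy Φ ≤ P.energy f := by
  set S : Set ℝ := P.energy '' {f | P.MemC1L2 f} with hS
  obtain ⟨b, hb⟩ := exists_lower_bound_energy P
  have hSb : BddBelow S := ⟨b, by rintro _ ⟨f, hf, rfl⟩; exact hb f hf⟩
  obtain ⟨u, hu_anti, hu_lim, hu_mem⟩ := exists_seq_tendsto_sInf (S := S) ⟨_, f₀, hf₀, rfl⟩ hSb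
  set m := sInf S with hm
  have hmle : ∀ f, P.MemC1L2 f → m ≤ P.energy f := fun f hf => csInf_le hSb ⟨f, hf, rfl⟩
  choose f hf hfu using hu_mem
  have hdist : ∀ i j N, N ≤ i → N ≤ j →
      dist ((hf i).2.toLp (f i)) ((hf j).2.toLp (f j)) ≤ √(8 * (u N - m)) := by
    intro i j N hi hj
    refine Real.le_sqrt_of_sq_le ?_
    have h1 := energy_midpoint (hf i) (hf j)
    have h2 := hmle _ (((hf i).const_smul (by norm_num : (0 : ℝ) ≤ 1 / 2)).add
      ((hf j).const_smul (by norm_num : (0 : ℝ) ≤ 1 / 2)))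
    rw [dist_eq_norm]
    have h3 := hu_anti hi
    have h4 := hu_anti hj
    rw [hfu i, hfu j] at h1
    linarith
  have hcauchy : CauchySeq fun k => (hf k).2.toLp (f k) := by
    refine cauchySeq_of_le_tendsto_0 _ hdist ?_
    have h1 : Tendsto (fun N => √(8 * (u N - m))) atTop (𝓝 √(8 * (m - m))) :=
      ((hu_lim.sub_const m).const_mul 8).sqrt
    simpa using h1
  obtain ⟨F, hF⟩ := cauchySeq_tendsto_of_complete hcauchy
  have hFm : MemLp F 2 P.μ := Lp.memLp F
  have hF' : Tendsto (fun k => (hf k).2.toLp (f k)) atTop (𝓝 (hFm.toLp F)) := by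
    rwa [Lp.toLp_coeFn]
  have hlim := (Lp.tendsto_Lp_iff_tendsto_eLpNorm'' f (fun k => (hf k).2) F hFm).1 hF'
  have hnorm : Tendsto (fun k => P.normL2 (f k)) atTop (𝓝 ‖F‖) := by
    simpa only [normL2_eq (hf _).2] using hF.norm
  have hint : Tendsto (fun k => ∫ x, f k x ∂P.μ) atTop (𝓝 (∫ x, F x ∂P.μ)) := by
    rw [integral_eq_inner_one hFm]
    simp only [integral_eq_inner_one (hf _).2]
    exact tendsto_const_nhds.inner hF'
  have hℓ : Tendsto (fun k => ∫ x, f k x ∂P.σ) atTop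
      (𝓝 (m - ‖F‖ ^ 2 / 2 + P.Shat * ∫ x, F x ∂P.μ)) := by
    have h1 : ∀ k, ∫ x, f k x ∂P.σ
        = u k - P.normL2 (f k) ^ 2 / 2 + P.Shat * ∫ x, f k x ∂P.μ := fun k => by
      rw [← hfu k, energy, L_eq]
      ring
    simp only [h1]
    exact (hu_lim.sub ((hnorm.pow 2).div_const 2)).add (hint.const_mul _)
  obtain ⟨M, hM⟩ := hnorm.bddAbove_range
  obtain ⟨C, hC, hCf⟩ := exists_lower_bound_normL2 P
  have hCM : ∀ k, ∀ x ∈ P.star, -(C * M) ≤ f k x := fun k x hx => by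
    have h1 := mul_le_mul_of_nonneg_left (hM (mem_range_self k)) hC
    have h2 := hCf (f k) (hf k) x hx
    linarith
  obtain ⟨Φ, hΦ, hΦF, hΦℓ⟩ := P.exists_memC1L2_of_tendsto hf hFm hlim hℓ hCM
  refine ⟨Φ, hΦ, fun f hf => le_trans ?_ (hmle f hf)⟩
  have h1 : hΦ.2.toLp Φ = F := by
    rw [← Lp.toLp_coeFn F hFm]
    exact (MemLp.toLp_eq_toLp_iff _ _).2 hΦF
  rw [energy_eq hΦ, h1, L_eq, integral_congr_ae hΦF]
  linarith

lemma _root_.nonneg_of_forall_mul_add_sq_mul_nonneg {a b : ℝ}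
    (h : ∀ ε ∈ Ioo (0 : ℝ) 1, 0 ≤ ε * a + ε ^ 2 * b) : 0 ≤ a := by
  have h1 : Tendsto (fun ε : ℝ => a + ε * b) (𝓝[>] 0) (𝓝 (a + 0 * b)) :=
    tendsto_const_nhds.add ((tendsto_nhdsWithin_of_tendsto_nhds tendsto_id).mul_const b)
  rw [zero_mul, add_zero] at h1
  refine ge_of_tendsto h1 ?_
  filter_upwards [Ioo_mem_nhdsGT (zero_lt_one' ℝ)] with ε hε
  refine nonneg_of_mul_nonneg_right (a := ε) ?_ hε.1
  linarith [h ε hε]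

/-- The variational inequality, and the Euler identity obtained by rescaling the minimiser. -/
lemma variation_of_energy_minimiser {Φ : EuclideanSpace ℝ (Fin n) → ℝ} (hΦ : P.MemC1L2 Φ)
    (hmin : ∀ f, P.MemC1L2 f → P.energy Φ ≤ P.energy f) :
    (∀ f (hf : P.MemC1L2 f), 0 ≤ P.L f + inner ℝ (hΦ.2.toLp Φ) (hf.2.toLp f)) ∧
      P.L Φ = -‖hΦ.2.toLp Φ‖ ^ 2 := by
  have hfirst : ∀ f (hf : P.MemC1L2 f), 0 ≤ P.L f + inner ℝ (hΦ.2.toLp Φ) (hf.2.toLp f) := by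
    intro f hf
    refine nonneg_of_forall_mul_add_sq_mul_nonneg (b := ‖hf.2.toLp f‖ ^ 2 / 2) fun ε hε => ?_
    have hεf := hf.const_smul hε.1.le
    have h1 := hmin _ (hΦ.add hεf)
    have h2 : (hΦ.add hεf).2.toLp _ = hΦ.2.toLp Φ + ε • hf.2.toLp f := rfl
    rw [energy_eq (hΦ.add hεf), energy_eq hΦ, L_add hΦ hεf, L_smul, h2, norm_add_sq_real,
      inner_smul_right, norm_smul, mul_pow, Real.norm_eq_abs, sq_abs] at h1
    linarith
  refine ⟨hfirst, ?_⟩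
  have hself := hfirst Φ hΦ
  rw [real_inner_self_eq_norm_sq] at hself
  have hle : 0 ≤ -(P.L Φ + ‖hΦ.2.toLp Φ‖ ^ 2) := by
    refine nonneg_of_forall_mul_add_sq_mul_nonneg (b := ‖hΦ.2.toLp Φ‖ ^ 2 / 2) fun ε hε => ?_
    have hεf := hΦ.const_smul (by linarith [hε.2] : 0 ≤ 1 - ε)
    have h1 := hmin _ hεf
    have h2 : hεf.2.toLp _ = (1 - ε) • hΦ.2.toLp Φ := rfl
    rw [energy_eq hεf, energy_eq hΦ, L_smul, h2, norm_smul, mul_pow, Real.norm_eq_abs,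
      sq_abs] at h1
    linarith
  linarith

end MomentPolytope

/-! ### The optimal destabilising function -/

theorem mainTheorem1 {n : ℕ} (P : MomentPolytope n) (hP : P.Unstable) :
    ∃ Φ : EuclideanSpace ℝ (Fin n) → ℝ,
      -- `Φ` is a convex minimiser, and the minimisers are exactly its positive multiples
      P.IsMinimiser Φ ∧
      (∀ Ψ : EuclideanSpace ℝ (Fin n) → ℝ,
        P.IsMinimiser Ψ ↔ ∃ c : ℝ, 0 < c ∧ Set.EqOn Ψ (fun x => c * Φ x) P.star) ∧
      -- `Φ` is the only minimiser with the normalisation `𝓛(Φ) = -‖Φ‖²`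
      P.L Φ = -(P.normL2 Φ) ^ 2 ∧
      (∀ Ψ : EuclideanSpace ℝ (Fin n) → ℝ,
        P.IsMinimiser Ψ → P.L Ψ = -(P.normL2 Ψ) ^ 2 → Set.EqOn Ψ Φ P.star) ∧
      -- with `B = Ŝ - Φ`: `𝓛_B(f) ≥ 0` for all convex `f`, and `𝓛_B(Φ) = 0`
      (∀ f : EuclideanSpace ℝ (Fin n) → ℝ,
        P.MemC1L2 f → 0 ≤ P.L_ (fun x => P.Shat - Φ x) f) ∧
      P.L_ (fun x => P.Shat - Φ x) Φ = 0 ∧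
      -- these two conditions characterise `Φ`
      (∀ Ψ : EuclideanSpace ℝ (Fin n) → ℝ, P.MemC1L2 Ψ →
        (∀ f : EuclideanSpace ℝ (Fin n) → ℝ,
          P.MemC1L2 f → 0 ≤ P.L_ (fun x => P.Shat - Ψ x) f) →
        P.L_ (fun x => P.Shat - Ψ x) Ψ = 0 →
        Set.EqOn Ψ Φ P.star) := by
  obtain ⟨f₀, hf₀, hLf₀⟩ := hP
  obtain ⟨Φ, hΦ, hmin⟩ := MomentPolytope.exists_energy_minimiser hf₀
  obtain ⟨hvar, hLΦ⟩ := MomentPolytope.variation_of_energy_minimiser hΦ hmin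
  have hN : P.normL2 Φ = ‖hΦ.2.toLp Φ‖ := MomentPolytope.normL2_eq hΦ.2
  -- Instability forces `Φ ≠ 0`.
  have hpos : 0 < P.normL2 Φ := by
    have h1 := hvar f₀ hf₀
    rw [hN, norm_pos_iff]
    intro h0
    rw [h0, inner_zero_left] at h1
    linarith
  have hWΦ : P.W Φ = -P.normL2 Φ := by
    rw [MomentPolytope.W, hLΦ, ← hN]
    field_simp
  have hCS : ∀ f, P.MemC1L2 f → -P.normL2 Φ ≤ P.W f := by
    intro f hf
    rcases (P.normL2_nonneg f).eq_or_lt with h0 | h0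
    · rw [MomentPolytope.W, ← h0, div_zero]
      linarith
    · have h1 := hvar f hf
      have h2 := real_inner_le_norm (hΦ.2.toLp Φ) (hf.2.toLp f)
      rw [← hN, ← MomentPolytope.normL2_eq hf.2] at h2
      rw [MomentPolytope.W, le_div_iff₀ h0]
      linarith
  have hΦmin : P.IsMinimiser Φ := ⟨hΦ, fun f hf => hWΦ ▸ hCS f hf⟩
  have hsmul : ∀ c : ℝ, 0 < c → ∀ Ψ : EuclideanSpace ℝ (Fin n) → ℝ,
      EqOn Ψ (fun x => c * Φ x) P.star →
      P.MemC1L2 Ψ ∧ P.L Ψ = c * P.L Φ ∧ P.normL2 Ψ = c * P.normL2 Φ := by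
    intro c hc Ψ hΨ
    have hcΦ := hΦ.const_smul hc.le
    have hΨc : P.MemC1L2 Ψ := hcΦ.congr hΨ.symm
    refine ⟨hΨc, ?_, ?_⟩
    · rw [MomentPolytope.L_congr hΨ]
      exact MomentPolytope.L_smul c Φ
    · have h1 : hΨc.2.toLp Ψ = c • hΦ.2.toLp Φ := by
        refine (MemLp.toLp_eq_toLp_iff hΨc.2 hcΦ.2).2 ?_
        filter_upwards [P.ae_μ_mem_interiorSet] with x hx
          using hΨ (P.interiorSet_subset_star hx)
      rw [MomentPolytope.normL2_eq hΨc.2, h1, norm_smul, Real.norm_of_nonneg hc.le, hN]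
  -- A minimiser realises equality in the Cauchy–Schwarz inequality with `Φ`.
  have huniq : ∀ Ψ, P.IsMinimiser Ψ →
      ∃ c : ℝ, 0 < c ∧ EqOn Ψ (fun x => c * Φ x) P.star := by
    rintro Ψ ⟨hΨ, hΨmin⟩
    have hWΨ : P.W Ψ ≤ -P.normL2 Φ := hWΦ ▸ hΨmin Φ hΦ
    have hΨpos : 0 < P.normL2 Ψ := by
      refine (P.normL2_nonneg Ψ).lt_of_ne fun h0 => ?_
      rw [MomentPolytope.W, ← h0, div_zero] at hWΨ
      linarith
    have hMΨ := MomentPolytope.normL2_eq hΨ.2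
    rw [MomentPolytope.W, div_le_iff₀ hΨpos] at hWΨ
    have h1 := hvar Ψ hΨ
    have h2 := real_inner_le_norm (hΦ.2.toLp Φ) (hΨ.2.toLp Ψ)
    have h3 : inner ℝ (hΦ.2.toLp Φ) (hΨ.2.toLp Ψ) = ‖hΦ.2.toLp Φ‖ * ‖hΨ.2.toLp Ψ‖ := by
      refine le_antisymm h2 ?_
      rw [← hN, ← hMΨ]
      linarith
    rw [inner_eq_norm_mul_iff_real, ← hN, ← hMΨ] at h3
    have hc : 0 < P.normL2 Ψ / P.normL2 Φ := div_pos hΨpos hpos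
    have hcΦ := hΦ.const_smul hc.le
    refine ⟨P.normL2 Ψ / P.normL2 Φ, hc, ?_⟩
    refine MomentPolytope.eqOn_star_of_ae_eq hΨ.1.continuousOn hcΦ.1.continuousOn
      ((MemLp.toLp_eq_toLp_iff hΨ.2 hcΦ.2).1 ?_)
    calc hΨ.2.toLp Ψ = (P.normL2 Φ)⁻¹ • P.normL2 Φ • hΨ.2.toLp Ψ := by
          rw [inv_smul_smul₀ hpos.ne']
      _ = (P.normL2 Ψ / P.normL2 Φ) • hΦ.2.toLp Φ := by
          rw [← h3, smul_smul, inv_mul_eq_div]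
      _ = hcΦ.2.toLp _ := rfl
  refine ⟨Φ, hΦmin, fun Ψ => ⟨huniq Ψ, ?_⟩, by rw [hLΦ, hN], ?_, ?_, ?_, ?_⟩
  · rintro ⟨c, hc, hΨ⟩
    obtain ⟨h1, h2, h3⟩ := hsmul c hc Ψ hΨ
    refine ⟨h1, fun f hf => ?_⟩
    rw [MomentPolytope.W, h2, h3, mul_div_mul_left _ _ hc.ne']
    exact hΦmin.2 f hf
  · intro Ψ hΨmin hΨL
    obtain ⟨c, hc, hΨ⟩ := huniq Ψ hΨmin
    obtain ⟨-, h2, h3⟩ := hsmul c hc Ψ hΨ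
    rw [h2, h3, hLΦ, ← hN] at hΨL
    have h4 : c * P.normL2 Φ ^ 2 * (c - 1) = 0 := by linarith
    have h5 : c = 1 := by
      have := (mul_eq_zero.1 h4).resolve_left (by positivity)
      linarith
    intro x hx
    simpa [h5] using hΨ hx
  · intro f hf
    rw [MomentPolytope.L_sub_eq_add_inner hΦ.2 hf]
    exact hvar f hf
  · rw [MomentPolytope.L_sub_eq_add_inner hΦ.2 hΦ, hLΦ, real_inner_self_eq_norm_sq]
    ring
  · intro Ψ hΨ hΨvar hΨ0
    -- Testing each function against the other gives `‖Φ - Ψ‖² ≤ 0`.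
    have h1 := hΨvar Φ hΦ
    have h2 := hvar Ψ hΨ
    rw [MomentPolytope.L_sub_eq_add_inner hΨ.2 hΦ, hLΦ, real_inner_comm] at h1
    rw [MomentPolytope.L_sub_eq_add_inner hΨ.2 hΨ, real_inner_self_eq_norm_sq] at hΨ0
    have h3 := norm_sub_sq_real (hΦ.2.toLp Φ) (hΨ.2.toLp Ψ)
    have h4 : ‖hΦ.2.toLp Φ - hΨ.2.toLp Ψ‖ ^ 2 ≤ 0 := by linarith
    have h5 : hΦ.2.toLp Φ = hΨ.2.toLp Ψ :=
      sub_eq_zero.1 (norm_eq_zero.1 (pow_eq_zero_iff two_ne_zero |>.1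
        (le_antisymm h4 (sq_nonneg _))))
    exact MomentPolytope.eqOn_star_of_ae_eq hΨ.1.continuousOn hΦ.1.continuousOn
      ((MemLp.toLp_eq_toLp_iff hΨ.2 hΦ.2).1 h5.symm)
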